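/- Let $\mathcal I\subseteq\mathbb R$ be a nondegenerate interval, $\mu\ge 2$, let $\ell_1\ge\dots\ge\ell_\mu\ge 0$ be integers, $m=\sum_{i=1}^{\mu}\ell_i$, and let $n\in\{0,1,2,\dots\}\cup\{\infty\}$. Let $N:\mathcal I\to\mathbb R^{m\times m}$ be a matrix function of class $C^{n+\mu}$, partitioned into blocks $N_{ij}:\mathcal I\to\mathbb R^{\ell_i\times\ell_j}$, $1\le i,j\le\mu$, such that $N_{ij}=0$ for $i\ge j$ (strictly block upper triangular) and $\operatorname{rank}N_{i,i+1}(t)=\ell_{i+1}$ for all $t\in\mathcal I$ and $i=1,\dots,\mu-1$ (full column rank). Let $N^{(E_c)}\in\mathbb R^{m\times m}$ be the constant matrix with the same block partition, whose secondary blocks are $N^{(E_c)}_{i,i+1}=\begin{bmatrix} I_{\ell_{i+1}}\\ 0\end{bmatrix}\in\mathbb R^{\ell_i\times\ell_{i+1}}$, $i=1,\dots,\mu-1$, and whose other blocks are zero. Then the pairs $\{N,I\}$ and $\{N^{(E_c)},I\}$ are equivalent: there exist pointwise nonsingular matrix functions $L,K:\mathcal I\to\mathbb R^{m\times m}$, with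 $L$ of class $C^{n}$ and $K$ of class $C^{n+1}$, such that on $\mathcal I$ $$N^{(E_c)}=L\,N\,K,\qquad I=L\,K+L\,N\,K'.$$ (For $n=\infty$: if $N$ is $C^\infty$, then $L$ and $K$ can be chosen $C^\infty$.) -/

import Mathlib

open scoped Matrix

/-- A matrix function, considered on the set `I`, is of class `C^n` on `I` (entrywise). -/
def MatContDiffOn {ι κ : Type*} (n : ℕ∞) (A : ℝ → Matrix ι κ ℝ) (I : Set ℝ) : Prop :=
  ∀ i j, ContDiffOn ℝ n (fun t => A t i j) I

/-- The entrywise derivative of a matrix function on `I` (one-sided at endpoints that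
belong to `I`). -/
noncomputable def matDerivWithin {ι κ : Type*} (A : ℝ → Matrix ι κ ℝ) (I : Set ℝ) (t : ℝ) :
    Matrix ι κ ℝ :=
  Matrix.of fun i j => derivWithin (fun s => A s i j) I t

/-- Equivalence of pairs of matrix functions `{E, F}` and `{E₁, F₁}` on `I`: there are pointwise
nonsingular `L, K` with `E₁ = L E K` and `F₁ = L F K + L E K'` on `I`. The smoothness of the
transformation is recorded by `n`: `L` is of class `C^n` and `K` of class `C^(n+1)`. -/
def PairEquiv {ι : Type*} [Fintype ι] [DecidableEq ι] (n : ℕ∞) (I : Set ℝ)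
    (E F E₁ F₁ : ℝ → Matrix ι ι ℝ) : Prop :=
  ∃ L K : ℝ → Matrix ι ι ℝ,
    MatContDiffOn n L I ∧ MatContDiffOn (n + 1) K I ∧
    (∀ t ∈ I, IsUnit (L t)) ∧ (∀ t ∈ I, IsUnit (K t)) ∧
    (∀ t ∈ I, E₁ t = L t * E t * K t) ∧
    (∀ t ∈ I, F₁ t = L t * F t * K t + L t * E t * matDerivWithin K I t)

/-- Row and column indices of square matrices partitioned into `μ × μ` blocks, the `(i, j)` block
having size `ℓ i × ℓ j`. -/
abbrev BlockIdx {μ : ℕ} (ℓ : Fin μ → ℕ) : Type := Σ i : Fin μ, Fin (ℓ i)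

/-- The `(i, j)` block of a partitioned matrix. -/
def block {μ : ℕ} {ℓ : Fin μ → ℕ} (A : Matrix (BlockIdx ℓ) (BlockIdx ℓ) ℝ) (i j : Fin μ) :
    Matrix (Fin (ℓ i)) (Fin (ℓ j)) ℝ :=
  Matrix.of fun a b => A ⟨i, a⟩ ⟨j, b⟩

/-- `N` is a strictly block upper triangular matrix function on `I`. -/
def IsSUT {μ : ℕ} (ℓ : Fin μ → ℕ) (I : Set ℝ)
    (N : ℝ → Matrix (BlockIdx ℓ) (BlockIdx ℓ) ℝ) : Prop :=
  ∀ t ∈ I, ∀ i j : Fin μ, j ≤ i → block (N t) i j = 0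

/-- The class of strictly block upper triangular matrix functions on `I` with nonincreasing block
sizes all of whose secondary blocks `N_{i,i+1}` have pointwise full column rank. -/
structure IsSUTColumns {μ : ℕ} (ℓ : Fin μ → ℕ) (I : Set ℝ)
    (N : ℝ → Matrix (BlockIdx ℓ) (BlockIdx ℓ) ℝ) : Prop where
  antitone : Antitone ℓ
  isSUT : IsSUT ℓ I N
  rank_eq : ∀ t ∈ I, ∀ i j : Fin μ, (j : ℕ) = (i : ℕ) + 1 → (block (N t) i j).rank = ℓ j

/-- The elementary matrix whose secondary blocks are `[I; 0]` (identity of size `ℓ (i + 1)` on top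
of zero rows) and whose other blocks are zero. -/
def elemColumns {μ : ℕ} (ℓ : Fin μ → ℕ) : Matrix (BlockIdx ℓ) (BlockIdx ℓ) ℝ :=
  Matrix.of fun p q =>
    if (q.1 : ℕ) = (p.1 : ℕ) + 1 ∧ (p.2 : ℕ) = (q.2 : ℕ) then 1 else 0

/-!
Write `E` for the constant elementary matrix. The second identity says that `L` is the inverse of
`K + N K'`, and the first one then becomes `(K + N K') E = N K`. Right multiplication by `E` shifts
block columns: it replaces block column `j` by the first `ℓ j` columns of block column `j - 1`, and
block column `0` by zero. Hence the columns `k_{j,a}` of `K` have to satisfy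
`k_{j-1,a} + N k_{j-1,a}' = N k_{j,a}` for `a < ℓ j`, together with `N k_{0,a} = 0`.

Since `N` is strictly block upper triangular, `g + N g' = N f` is solvable for every right-hand side,
by iterating `g ↦ N (f - g')` (`HasGrade.exists_solution`). So `K` is built from the last block column
to the first: columns `a < ℓ j` of block column `j - 1` are the solutions for the columns of block
column `j`, and the other `ℓ (j - 1) - ℓ j` columns are free. If block column `j` is supported in
the blocks `0, …, j`, then these solutions are supported in the blocks `0, …, j - 1`. So `K` is block
upper triangular, and so is `K + N K'`, with the same diagonal blocks. The leading blocks of the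
solutions are `N_{j-1,j}` applied to the diagonal block `K_{jj}`, hence linearly independent by full
column rank, and the free columns are chosen to complete them to a basis. This makes `K` and
`K + N K'` nonsingular.

The count of derivatives is kept by `HasGrade`: block `K_{ij}` is of class `C^(n+μ-(j-i))`. Solving
for the next block column preserves this pattern, because `N` shifts blocks by one whenever a
derivative is taken. The worst case is `K_{0,μ-1}`, which is of class `C^(n+1)`.

The completion to a basis (`exists_contDiffOn_basis_extension`) adds one vector at a time to `q`
independent functions with values in `ℝ^p`. If `q + 1 < p`, the spans along the whole interval form
the image of a `C^1` map from a set of dimension `q + 1`, so by the easy case of Sard's theorem some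
constant vector avoids all of them. If `q + 1 = p`, the vector of cofactors works.
-/

/-! ### Completing a smooth linearly independent family -/

theorem contDiffOn_det {ι : Type*} [Fintype ι] [DecidableEq ι] {k : WithTop ℕ∞} {I : Set ℝ}
    {A : ℝ → Matrix ι ι ℝ} (hA : ∀ i j, ContDiffOn ℝ k (fun t => A t i j) I) :
    ContDiffOn ℝ k (fun t => (A t).det) I := by
  simp only [Matrix.det_apply']
  exact ContDiffOn.sum fun σ _ => contDiffOn_const.mul (contDiffOn_prod fun i _ => hA _ _)

/-- The curve of spans sweeps out a set of Hausdorff dimension at most `q + 1`, so a constant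
vector avoids it when `q + 1 < p`. -/
theorem exists_const_notMem_span {p q : ℕ} (hpq : q + 1 < p) {k : WithTop ℕ∞} (hk : 1 ≤ k)
    {I : Set ℝ} (hI : Convex ℝ I) {a : Fin q → ℝ → Fin p → ℝ}
    (ha : ∀ i, ContDiffOn ℝ k (a i) I) :
    ∃ v : Fin p → ℝ, ∀ t ∈ I, v ∉ Submodule.span ℝ (Set.range fun i => a i t) := by
  let f : ℝ × (Fin q → ℝ) → Fin p → ℝ := fun x => ∑ i, x.2 i • a i x.1
  have hf : ContDiffOn ℝ 1 f (I ×ˢ Set.univ) := by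
    refine ContDiffOn.sum fun i _ => ContDiffOn.fun_smul ?_ ?_
    · exact ((contDiff_apply ℝ ℝ i).comp contDiff_snd).contDiffOn
    · exact ((ha i).of_le hk).comp contDiffOn_fst fun x hx => hx.1
  have hd : dimH (I ×ˢ (Set.univ : Set (Fin q → ℝ))) < Module.finrank ℝ (Fin p → ℝ) := by
    refine (dimH_mono (Set.subset_univ _)).trans_lt ?_
    rw [Real.dimH_univ_eq_finrank]
    simp only [Module.finrank_prod, Module.finrank_self, Module.finrank_fin_fun]
    exact_mod_cast (by omega : 1 + q < p)
  obtain ⟨v, hv⟩ := (hf.dense_compl_image_of_dimH_lt_finrank (hI.prod convex_univ)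
    subset_rfl hd).nonempty
  refine ⟨v, fun t ht hmem => hv ?_⟩
  obtain ⟨c, hc⟩ := (Submodule.mem_span_range_iff_exists_fun ℝ).1 hmem
  exact ⟨(t, c), ⟨ht, trivial⟩, hc⟩

/-- The vector of cofactors along the missing row of `q` independent vectors in dimension `q + 1`
lies outside their span: its pairing with `x` is the determinant obtained by adjoining `x`. -/
theorem cofactor_notMem_span {q : ℕ} {a : Fin q → Fin (q + 1) → ℝ}
    (ha : LinearIndependent ℝ a) :
    (fun i => (Matrix.of (Fin.snoc a (Pi.single i 1) : Fin (q + 1) → Fin (q + 1) → ℝ)).det) ∉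
      Submodule.span ℝ (Set.range a) := by
  let D : (Fin (q + 1) → ℝ) →ₗ[ℝ] ℝ :=
    (Matrix.detRowAlternating (R := ℝ) (n := Fin (q + 1))).toMultilinearMap.toLinearMap
      (Fin.snoc a 0 : Fin (q + 1) → Fin (q + 1) → ℝ) (Fin.last q)
  have hD : ∀ x, D x = (Matrix.of (Fin.snoc a x : Fin (q + 1) → Fin (q + 1) → ℝ)).det := by
    intro x
    change (Matrix.of (Function.update (Fin.snoc a 0 : Fin (q + 1) → Fin (q + 1) → ℝ)
      (Fin.last q) x)).det = _
    rw [Fin.update_snoc_last]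
  have hdet : ∀ x, D x ≠ 0 ↔ x ∉ Submodule.span ℝ (Set.range a) := by
    intro x
    rw [hD, ← isUnit_iff_ne_zero, ← Matrix.isUnit_iff_isUnit_det,
      ← Matrix.linearIndependent_rows_iff_isUnit]
    exact linearIndependent_finSnoc.trans (and_iff_right ha)
  simp only [← hD]
  rw [← hdet]
  have hsum : ∀ x, D x = ∑ i, x i * D (Pi.single i 1) := by
    intro x
    conv_lhs => rw [pi_eq_sum_univ' x, map_sum]
    simp only [map_smul, smul_eq_mul]
  rw [hsum]
  intro h0
  have hz : ∀ i, D (Pi.single i 1) = 0 := by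
    intro i
    have := (Finset.sum_eq_zero_iff_of_nonneg fun i _ => mul_self_nonneg _).1 h0 i
      (Finset.mem_univ i)
    exact mul_self_eq_zero.1 this
  -- `q` vectors do not span a space of dimension `q + 1`
  have hne : Submodule.span ℝ (Set.range a) ≠ ⊤ := by
    intro htop
    have h1 := finrank_span_eq_card ha
    rw [htop, finrank_top] at h1
    simp at h1
  obtain ⟨x, hx⟩ := SetLike.exists_not_mem_of_ne_top _ hne
  refine (hdet x).2 hx ?_
  rw [hsum]
  simp [hz]

theorem exists_contDiffOn_notMem_span {p q : ℕ} (hpq : q < p) {k : WithTop ℕ∞} (hk : 1 ≤ k)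
    {I : Set ℝ} (hI : Convex ℝ I) {a : Fin q → ℝ → Fin p → ℝ}
    (ha : ∀ i, ContDiffOn ℝ k (a i) I) (hli : ∀ t ∈ I, LinearIndependent ℝ fun i => a i t) :
    ∃ b : ℝ → Fin p → ℝ, ContDiffOn ℝ k b I ∧
      ∀ t ∈ I, b t ∉ Submodule.span ℝ (Set.range fun i => a i t) := by
  obtain h | h := (Nat.succ_le_of_lt hpq).lt_or_eq
  · obtain ⟨v, hv⟩ := exists_const_notMem_span h hk hI ha
    exact ⟨fun _ => v, contDiffOn_const, hv⟩
  · subst h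
    refine ⟨fun t i => (Matrix.of
      (Fin.snoc (fun i => a i t) (Pi.single i 1) : Fin (q + 1) → Fin (q + 1) → ℝ)).det, ?_,
      fun t ht => cofactor_notMem_span (hli t ht)⟩
    refine contDiffOn_pi.2 fun i => contDiffOn_det fun r c => ?_
    refine Fin.lastCases ?_ (fun r => ?_) r
    · simp only [Matrix.of_apply, Fin.snoc_last]
      exact contDiffOn_const
    · simp only [Matrix.of_apply, Fin.snoc_castSucc]
      exact contDiffOn_pi.1 (ha r) c

/-- A pointwise linearly independent family of `q` functions of class `C^k`, `k ≥ 1`, with values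
in `ℝ^p` extends to a `C^k` family of bases. -/
theorem exists_contDiffOn_basis_extension {p q : ℕ} (hpq : q ≤ p) {k : WithTop ℕ∞} (hk : 1 ≤ k)
    {I : Set ℝ} (hI : Convex ℝ I) {a : Fin q → ℝ → Fin p → ℝ}
    (ha : ∀ i, ContDiffOn ℝ k (a i) I) (hli : ∀ t ∈ I, LinearIndependent ℝ fun i => a i t) :
    ∃ b : Fin p → ℝ → Fin p → ℝ, (∀ i, ContDiffOn ℝ k (b i) I) ∧
      (∀ t ∈ I, LinearIndependent ℝ fun i => b i t) ∧ ∀ i, b (Fin.castLE hpq i) = a i := by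
  induction hd : p - q generalizing q with
  | zero =>
    obtain rfl : q = p := by omega
    exact ⟨a, ha, hli, fun i => rfl⟩
  | succ d ih =>
    have hlt : q < p := by omega
    obtain ⟨c, hc, hc'⟩ := exists_contDiffOn_notMem_span hlt hk hI ha hli
    obtain ⟨b, hb, hbli, hbe⟩ := ih (q := q + 1) (a := Fin.snoc a c) (by omega)
      (fun i => by
        refine Fin.lastCases ?_ (fun i => ?_) i
        · simpa only [Fin.snoc_last] using hc
        · simpa only [Fin.snoc_castSucc] using ha i)
      (fun t ht => by
        have heq : (fun i => (Fin.snoc a c : Fin (q + 1) → ℝ → Fin p → ℝ) i t) =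
            (Fin.snoc (fun i => a i t) (c t) : Fin (q + 1) → Fin p → ℝ) := by
          funext i
          refine Fin.lastCases ?_ (fun i => ?_) i
          · simp only [Fin.snoc_last]
          · simp only [Fin.snoc_castSucc]
        rw [heq]
        exact (hli t ht).finSnoc (hc' t ht)) (by omega)
    refine ⟨b, hb, hbli, fun i => ?_⟩
    have h2 := hbe i.castSucc
    rw [Fin.snoc_castSucc] at h2
    exact h2

/-! ### The graded function spaces and the equation `g + N g' = N f` -/

/-- The vector functions of grade `j`: on `I` the components in the blocks below block `j` vanish,
and the components in block `i` are of class `C^s'` with `s' = n + μ - (j - i)`. The subtraction is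
avoided by asking for class `C^(n+s)` whenever `s + j ≤ μ + i`; for `i > j` this claims more than
`C^(n+μ)`, but only of functions that vanish. -/
def HasGrade {μ : ℕ} {ℓ : Fin μ → ℕ} (I : Set ℝ) (n : ℕ∞) (j : ℕ) (f : ℝ → BlockIdx ℓ → ℝ) :
    Prop :=
  (∀ p : BlockIdx ℓ, j < (p.1 : ℕ) → ∀ t ∈ I, f t p = 0) ∧
    ∀ (p : BlockIdx ℓ) (s : ℕ), s + j ≤ μ + (p.1 : ℕ) →
      ContDiffOn ℝ ((n + s : ℕ∞) : WithTop ℕ∞) (fun t => f t p) I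

/-- The componentwise derivative of a vector function on `I`. -/
noncomputable def vecDerivWithin {ι : Type*} (f : ℝ → ι → ℝ) (I : Set ℝ) (t : ℝ) : ι → ℝ :=
  fun p => derivWithin (fun s => f s p) I t

section

variable {μ : ℕ} {ℓ : Fin μ → ℕ} {I : Set ℝ} {n : ℕ∞}
  {N : ℝ → Matrix (BlockIdx ℓ) (BlockIdx ℓ) ℝ}

theorem IsSUT.apply_eq_zero (hN : IsSUT ℓ I N) {t : ℝ} (ht : t ∈ I) {p q : BlockIdx ℓ}
    (h : (q.1 : ℕ) ≤ p.1) : N t p q = 0 :=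
  congrFun (congrFun (hN t ht p.1 q.1 h) p.2) q.2

theorem derivWithin_eq_zero_of_forall_mem {f : ℝ → ℝ} (hf : ∀ t ∈ I, f t = 0) {t : ℝ}
    (ht : t ∈ I) : derivWithin f I t = 0 := by
  rw [derivWithin_congr (f := fun _ => 0) (fun s hs => hf s hs) (hf t ht)]
  simp

theorem HasGrade.zero (j : ℕ) : HasGrade I n j (0 : ℝ → BlockIdx ℓ → ℝ) :=
  ⟨fun _ _ _ _ => rfl, fun _ _ _ => contDiffOn_const⟩

theorem HasGrade.sub {j : ℕ} {f g : ℝ → BlockIdx ℓ → ℝ} (hf : HasGrade I n j f)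
    (hg : HasGrade I n j g) : HasGrade I n j (f - g) :=
  ⟨fun p hp t ht => by simp [hf.1 p hp t ht, hg.1 p hp t ht],
    fun p s hs => (hf.2 p s hs).sub (hg.2 p s hs)⟩

theorem HasGrade.deriv_eq_zero {j : ℕ} {f : ℝ → BlockIdx ℓ → ℝ}
    (hf : HasGrade I n j f) {p : BlockIdx ℓ} (hp : j < (p.1 : ℕ)) {t : ℝ} (ht : t ∈ I) :
    vecDerivWithin f I t p = 0 :=
  derivWithin_eq_zero_of_forall_mem (hf.1 p hp) ht

theorem HasGrade.deriv (hI : UniqueDiffOn ℝ I) {j : ℕ} {f : ℝ → BlockIdx ℓ → ℝ}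
    (hf : HasGrade I n j f) : HasGrade I n (j + 1) (vecDerivWithin f I) := by
  refine ⟨fun p hp t ht => hf.deriv_eq_zero (by omega) ht, fun p s hs => ?_⟩
  refine (hf.2 p (s + 1) (by omega)).derivWithin hI ?_
  push_cast
  rw [add_assoc]

/-- `N` lowers the grade by one: row block `i` of `N` only involves the blocks `l > i`, whose
components have at least one derivative more. -/
theorem HasGrade.mulVec (hsmooth : MatContDiffOn (n + μ) N I) (hN : IsSUT ℓ I N) {j : ℕ}
    {f : ℝ → BlockIdx ℓ → ℝ} (hf : HasGrade I n (j + 1) f) :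
    HasGrade I n j (fun t => N t *ᵥ f t) := by
  have hterm : ∀ p q : BlockIdx ℓ, (q.1 : ℕ) ≤ p.1 ∨ j + 1 < (q.1 : ℕ) →
      ∀ t ∈ I, N t p q * f t q = 0 := by
    rintro p q (h | h) t ht
    · rw [hN.apply_eq_zero ht h, zero_mul]
    · rw [hf.1 q h t ht, mul_zero]
  constructor
  · intro p hp t ht
    exact Finset.sum_eq_zero fun q _ => hterm p q (by omega) t ht
  · intro p s hs
    refine ContDiffOn.sum (f := fun q t => N t p q * f t q) fun q _ => ?_
    by_cases h : (q.1 : ℕ) ≤ p.1 ∨ j + 1 < (q.1 : ℕ)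
    · exact contDiffOn_const.congr (hterm p q h)
    · have hsμ : s ≤ μ := by omega
      refine ((hsmooth p q).of_le ?_).mul (hf.2 q s (by omega))
      exact_mod_cast add_le_add le_rfl (Nat.cast_le.2 hsμ : (s : ℕ∞) ≤ μ)

/-- Since `N` is nilpotent, the iteration `g ↦ N (f - g')` becomes stationary after `μ` steps, and
its limit solves `g + N g' = N f`. Each application of `N` makes up for the derivative lost by
differentiation. -/
theorem HasGrade.exists_solution (hI : UniqueDiffOn ℝ I) (hsmooth : MatContDiffOn (n + μ) N I)
    (hN : IsSUT ℓ I N) {j : ℕ} {f : ℝ → BlockIdx ℓ → ℝ} (hf : HasGrade I n (j + 1) f) :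
    ∃ g, HasGrade I n j g ∧ ∀ t ∈ I, g t + N t *ᵥ vecDerivWithin g I t = N t *ᵥ f t := by
  let T : (ℝ → BlockIdx ℓ → ℝ) → ℝ → BlockIdx ℓ → ℝ :=
    fun g t => N t *ᵥ (f - vecDerivWithin g I) t
  have hgrade : ∀ c, HasGrade I n j (T^[c] 0) := by
    intro c
    induction c with
    | zero => exact HasGrade.zero j
    | succ c ih =>
      rw [Function.iterate_succ_apply']
      exact (hf.sub (ih.deriv hI)).mulVec hsmooth hN
  have hstat : ∀ c, ∀ p : BlockIdx ℓ, μ ≤ p.1 + c → ∀ t ∈ I, (T^[c + 1] 0) t p = (T^[c] 0) t p := by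
    intro c
    induction c with
    | zero => exact fun p hp => absurd p.1.isLt (by omega)
    | succ c ih =>
      intro p hp t ht
      have happ : ∀ c, (T^[c + 1] 0) t p =
          ∑ q, N t p q * (f t q - vecDerivWithin (T^[c] 0) I t q) := fun c => by
        rw [Function.iterate_succ_apply']
        rfl
      rw [happ (c + 1), happ c]
      refine Finset.sum_congr rfl fun q _ => ?_
      by_cases hq : (q.1 : ℕ) ≤ p.1
      · rw [hN.apply_eq_zero ht hq, zero_mul, zero_mul]
      · have hE := ih q (by omega)
        have : vecDerivWithin (T^[c + 1] 0) I t q = vecDerivWithin (T^[c] 0) I t q :=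
          derivWithin_congr (fun s hs => hE s hs) (hE t ht)
        rw [this]
  refine ⟨T^[μ] 0, hgrade μ, fun t ht => ?_⟩
  have h1 : (T^[μ] 0) t = N t *ᵥ (f t - vecDerivWithin (T^[μ] 0) I t) := by
    funext p
    rw [← hstat μ p (by omega) t ht, Function.iterate_succ_apply']
    rfl
  rw [Matrix.mulVec_sub] at h1
  exact eq_sub_iff_add_eq.1 h1

/-- Block `i` of a solution of grade `i` is `N_{i,i+1}` applied to block `i + 1` of the right-hand
side: all terms with derivatives lie in higher blocks. -/
theorem HasGrade.leading_block_eq (hN : IsSUT ℓ I N) {i j : Fin μ} (hij : (j : ℕ) = i + 1)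
    {f g : ℝ → BlockIdx ℓ → ℝ} (hf : HasGrade I n j f) (hg : HasGrade I n i g) {t : ℝ}
    (ht : t ∈ I) (h : g t + N t *ᵥ vecDerivWithin g I t = N t *ᵥ f t) :
    (fun b => g t ⟨i, b⟩) = block (N t) i j *ᵥ fun b => f t ⟨j, b⟩ := by
  funext b
  have hb := congrFun h ⟨i, b⟩
  have h0 : (N t *ᵥ vecDerivWithin g I t) ⟨i, b⟩ = 0 := by
    refine Finset.sum_eq_zero fun q _ => ?_
    change N t ⟨i, b⟩ q * vecDerivWithin g I t q = 0
    by_cases hq : (q.1 : ℕ) ≤ i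
    · rw [hN.apply_eq_zero (p := ⟨i, b⟩) ht hq, zero_mul]
    · rw [hg.deriv_eq_zero (Nat.lt_of_not_le hq) ht, mul_zero]
  rw [Pi.add_apply, h0, add_zero] at hb
  rw [hb]
  change ∑ q : BlockIdx ℓ, N t ⟨i, b⟩ q * f t q = ∑ c, N t ⟨i, b⟩ ⟨j, c⟩ * f t ⟨j, c⟩
  rw [Fintype.sum_sigma]
  refine Finset.sum_eq_single j (fun k _ hk => Finset.sum_eq_zero fun c _ => ?_) (by simp)
  by_cases hq : (k : ℕ) ≤ i
  · rw [hN.apply_eq_zero ht (show ((⟨k, c⟩ : BlockIdx ℓ).1 : ℕ) ≤ i from hq), zero_mul]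
  · have hkj : (k : ℕ) ≠ j := fun h => hk (Fin.ext h)
    rw [hf.1 ⟨k, c⟩ (by change (j : ℕ) < k; omega) t ht, mul_zero]

end

/-! ### Families of columns with independent diagonal blocks -/

/-- A family of `ℓ j` functions of grade `j` whose values in block `j` form a basis of `ℝ^(ℓ j)` at
every point of `I`. It serves as the `j`-th block column of the transformation `K`. -/
def IsGradedBasis {μ : ℕ} {ℓ : Fin μ → ℕ} (I : Set ℝ) (n : ℕ∞) (j : Fin μ)
    (F : Fin (ℓ j) → ℝ → BlockIdx ℓ → ℝ) : Prop :=
  (∀ a, HasGrade I n j (F a)) ∧ ∀ t ∈ I, LinearIndependent ℝ fun a b => F a t ⟨j, b⟩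

section

variable {μ : ℕ} {ℓ : Fin μ → ℕ} {I : Set ℝ} {n : ℕ∞}
  {N : ℝ → Matrix (BlockIdx ℓ) (BlockIdx ℓ) ℝ}

theorem exists_isGradedBasis_extension (hI : Convex ℝ I) {j : Fin μ} {q : ℕ} (hq : q ≤ ℓ j)
    {G₀ : Fin q → ℝ → BlockIdx ℓ → ℝ} (hG : ∀ a, HasGrade I n j (G₀ a))
    (hli : ∀ t ∈ I, LinearIndependent ℝ fun a b => G₀ a t ⟨j, b⟩) :
    ∃ G, IsGradedBasis I n j G ∧ ∀ a, G (Fin.castLE hq a) = G₀ a := by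
  have hk : (1 : WithTop ℕ∞) ≤ ((n + μ : ℕ∞) : WithTop ℕ∞) := by
    have h1 : (1 : ℕ∞) ≤ μ := by exact_mod_cast (show 1 ≤ μ from Fin.pos j)
    exact_mod_cast h1.trans le_add_self
  obtain ⟨b, hb, hbli, hbe⟩ := exists_contDiffOn_basis_extension hq hk hI
    (a := fun a t c => G₀ a t ⟨j, c⟩)
    (fun a => contDiffOn_pi.2 fun c => (hG a).2 ⟨j, c⟩ μ le_rfl) hli
  -- the new columns are supported in block `j`
  let B : Fin (ℓ j) → ℝ → BlockIdx ℓ → ℝ := fun a t p =>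
    if h : p.1 = j then b a t (Fin.cast (congrArg ℓ h) p.2) else 0
  have hBj : ∀ a t c, B a t ⟨j, c⟩ = b a t c := fun a t c => by simp [B]
  have hB0 : ∀ a t (p : BlockIdx ℓ), p.1 ≠ j → B a t p = 0 := fun a t p hp => by simp [B, hp]
  have hB : ∀ a, HasGrade I n j (B a) := by
    refine fun a => ⟨fun p hp t _ => hB0 a t p fun h => ?_, ?_⟩
    · rw [h] at hp
      exact hp.false
    · rintro ⟨i, c⟩ s hs
      by_cases h : i = j
      · subst h
        have hsμ : s ≤ μ := by simpa using hs
        simp only [hBj]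
        refine (contDiffOn_pi.1 (hb a) c).of_le ?_
        exact_mod_cast add_le_add le_rfl (Nat.cast_le.2 hsμ : (s : ℕ∞) ≤ μ)
      · simp only [hB0 a _ ⟨i, c⟩ h]
        exact contDiffOn_const
  let G : Fin (ℓ j) → ℝ → BlockIdx ℓ → ℝ := fun a =>
    if h : (a : ℕ) < q then G₀ ⟨a, h⟩ else B a
  have hGb : ∀ a t c, G a t ⟨j, c⟩ = b a t c := by
    intro a t c
    by_cases h : (a : ℕ) < q
    · simp only [G, h, dif_pos]
      exact (congrFun (congrFun (hbe ⟨a, h⟩) t) c).symm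
    · simp only [G, h, dif_neg, not_false_eq_true]
      exact hBj a t c
  refine ⟨G, ⟨fun a => ?_, fun t ht => ?_⟩, fun a => ?_⟩
  · by_cases h : (a : ℕ) < q
    · simpa only [G, h, dif_pos] using hG ⟨a, h⟩
    · simpa only [G, h, dif_neg, not_false_eq_true] using hB a
  · simpa only [hGb] using hbli t ht
  · simp [G]

theorem mulVec_injective_of_rank_eq {p q : ℕ} {A : Matrix (Fin p) (Fin q) ℝ} (hA : A.rank = q) :
    Function.Injective A.mulVec := by
  rw [Matrix.mulVec_injective_iff, linearIndependent_iff_card_eq_finrank_span, Fintype.card_fin,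
    Set.finrank, ← Matrix.rank_eq_finrank_span_cols, hA]

/-- Passing from block column `j = i + 1` to block column `i`: the solutions of `g + N g' = N f`
have independent leading blocks because `N_{i,i+1}` has full column rank, and the remaining columns
are supplied by completing them to a basis. -/
theorem IsGradedBasis.exists_pred (hI : Convex ℝ I) (hI' : UniqueDiffOn ℝ I)
    (hsmooth : MatContDiffOn (n + μ) N I) (hN : IsSUTColumns ℓ I N) {i j : Fin μ}
    (hij : (j : ℕ) = i + 1) (hle : ℓ j ≤ ℓ i) {F : Fin (ℓ j) → ℝ → BlockIdx ℓ → ℝ}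
    (hF : IsGradedBasis I n j F) :
    ∃ G, IsGradedBasis I n i G ∧ ∀ a, ∀ t ∈ I,
      G (Fin.castLE hle a) t + N t *ᵥ vecDerivWithin (G (Fin.castLE hle a)) I t =
        N t *ᵥ F a t := by
  have hex := fun a => HasGrade.exists_solution (j := i) hI' hsmooth hN.isSUT
    (by rw [← hij]; exact hF.1 a)
  choose G₀ hG₀ hEq using hex
  obtain ⟨G, hG, hGe⟩ := exists_isGradedBasis_extension hI hle hG₀ fun t ht => by
    have hlead : (fun a b => G₀ a t ⟨i, b⟩) =
        fun a => block (N t) i j *ᵥ fun b => F a t ⟨j, b⟩ := funext fun a =>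
      HasGrade.leading_block_eq hN.isSUT hij (hF.1 a) (hG₀ a) ht (hEq a t ht)
    rw [hlead]
    exact (hF.2 t ht).map' (block (N t) i j).mulVecLin
      (LinearMap.ker_eq_bot.2 (mulVec_injective_of_rank_eq (hN.rank_eq t ht i j hij)))
  refine ⟨G, hG, fun a t ht => ?_⟩
  rw [hGe]
  exact hEq a t ht

/-- Dependent choice along `Fin μ`, from the last index downwards. -/
theorem Fin.exists_chain_of_pred {μ : ℕ} {X : Fin μ → Type*} {Q : ∀ j, X j → Prop}
    {R : ∀ i j, X i → X j → Prop} (last : ∀ j : Fin μ, ∃ x, Q j x)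
    (pred : ∀ i j : Fin μ, (j : ℕ) = i + 1 → ∀ y, Q j y → ∃ x, Q i x ∧ R i j x y) :
    ∃ K : ∀ j, X j, (∀ j, Q j (K j)) ∧ ∀ i j : Fin μ, (j : ℕ) = i + 1 → R i j (K i) (K j) := by
  cases μ with
  | zero => exact ⟨fun j => j.elim0, fun j => j.elim0, fun j => j.elim0⟩
  | succ m =>
    choose x hx using last (Fin.last m)
    choose g hg hgR using fun i : Fin m => pred i.castSucc i.succ (by simp)
    let K : ∀ j, {x : X j // Q j x} := Fin.reverseInduction (motive := fun j => {x : X j // Q j x})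
      ⟨x, hx⟩ fun i y => ⟨g i y.1 y.2, hg i y.1 y.2⟩
    refine ⟨fun j => (K j).1, fun j => (K j).2, fun i j hij => ?_⟩
    obtain ⟨i, rfl⟩ : ∃ i' : Fin m, i = i'.castSucc :=
      ⟨⟨i, by have := j.isLt; omega⟩, rfl⟩
    obtain rfl : j = i.succ := Fin.ext (by simpa using hij)
    have hK : K i.castSucc = ⟨g i (K i.succ).1 (K i.succ).2, hg i (K i.succ).1 (K i.succ).2⟩ :=
      Fin.reverseInduction_castSucc i
    simp only [hK]
    exact hgR i _ _

end

/-! ### Block triangular transformations -/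

section

variable {μ : ℕ} {ℓ : Fin μ → ℕ}

theorem isUnit_of_block_triangular {A : Matrix (BlockIdx ℓ) (BlockIdx ℓ) ℝ}
    (htri : ∀ p q : BlockIdx ℓ, (q.1 : ℕ) < p.1 → A p q = 0)
    (hdiag : ∀ j, LinearIndependent ℝ (block A j j).col) : IsUnit A := by
  have hA : A.BlockTriangular Sigma.fst := fun p q h => htri p q h
  rw [Matrix.isUnit_iff_isUnit_det, isUnit_iff_ne_zero, hA.det_fintype, Finset.prod_ne_zero_iff]
  intro j _
  have h1 := (Matrix.isUnit_iff_isUnit_det _).1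
    (Matrix.linearIndependent_cols_iff_isUnit.1 (hdiag j))
  have h2 : A.toSquareBlock Sigma.fst j =
      (block A j j).submatrix (Equiv.sigmaSubtype j) (Equiv.sigmaSubtype j) := by
    ext ⟨⟨i, a⟩, hi⟩ ⟨⟨k, b⟩, hk⟩
    dsimp only at hi hk
    subst hi
    subst hk
    rfl
  rw [h2, Matrix.det_submatrix_equiv_self]
  exact h1.ne_zero

/-- The inverse of a pointwise nonsingular matrix function is as smooth as the function, by Cramer's
rule. -/
theorem MatContDiffOn.inv {ι : Type*} [Fintype ι] [DecidableEq ι] {n : ℕ∞} {I : Set ℝ}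
    {A : ℝ → Matrix ι ι ℝ} (hA : MatContDiffOn n A I) (hu : ∀ t ∈ I, IsUnit (A t)) :
    MatContDiffOn n (fun t => (A t)⁻¹) I := by
  intro i j
  have hdet : ∀ t ∈ I, (A t).det ≠ 0 := fun t ht =>
    ((Matrix.isUnit_iff_isUnit_det _).1 (hu t ht)).ne_zero
  simp only [Matrix.inv_def, Matrix.smul_apply, Ring.inverse_eq_inv', smul_eq_mul,
    Matrix.adjugate_apply]
  refine ((contDiffOn_det hA).inv hdet).mul (contDiffOn_det fun r c => ?_)
  by_cases hr : r = j
  · subst hr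
    simp only [Matrix.updateRow_self]
    exact contDiffOn_const
  · simp only [Matrix.updateRow_ne hr]
    exact hA r c

end

/-! ### The equivalence transformation -/

theorem proposition1 {μ : ℕ} (hμ : 2 ≤ μ) (ℓ : Fin μ → ℕ)
    (I : Set ℝ) (hI : I.OrdConnected) (hI' : I.Nontrivial)
    (n : ℕ∞) (N : ℝ → Matrix (BlockIdx ℓ) (BlockIdx ℓ) ℝ)
    (hsmooth : MatContDiffOn (n + μ) N I) (hN : IsSUTColumns ℓ I N) :
    PairEquiv n I N (fun _ => 1) (fun _ => elemColumns ℓ) (fun _ => 1) := by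
  have hconv : Convex ℝ I := hI.convex
  have hud : UniqueDiffOn ℝ I :=
    uniqueDiffOn_convex hconv (hconv.nontrivial_iff_nonempty_interior.1 hI')
  have hanti : ∀ i j : Fin μ, (j : ℕ) = i + 1 → ℓ j ≤ ℓ i := fun i j hij =>
    hN.antitone (by rw [Fin.le_def]; omega)
  obtain ⟨k, hk, hrec⟩ := Fin.exists_chain_of_pred
    (X := fun j => Fin (ℓ j) → ℝ → BlockIdx ℓ → ℝ) (Q := fun j F => IsGradedBasis I n j F)
    (R := fun i j G F => ∀ (hle : ℓ j ≤ ℓ i) a, ∀ t ∈ I,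
      G (Fin.castLE hle a) t + N t *ᵥ vecDerivWithin (G (Fin.castLE hle a)) I t = N t *ᵥ F a t)
    -- in the last block column any graded basis will do, for instance a completion of no columns
    (fun j => by
      obtain ⟨G, hG, -⟩ := exists_isGradedBasis_extension (n := n) (j := j) hconv (Nat.zero_le _)
        (G₀ := fun a => a.elim0) (fun a => a.elim0) fun _ _ => linearIndependent_empty_type
      exact ⟨G, hG⟩)
    (fun i j hij F hF => by
      obtain ⟨G, hG, hGF⟩ := hF.exists_pred hconv hud hsmooth hN hij (hanti i j hij)
      exact ⟨G, hG, fun _ => hGF⟩)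
  -- `K` is determined by its columns; `I = L K + L N K'` then forces `L` to be the inverse of `M`
  let K : ℝ → Matrix (BlockIdx ℓ) (BlockIdx ℓ) ℝ := fun t => Matrix.of fun p q => k q.1 q.2 t p
  let M : ℝ → Matrix (BlockIdx ℓ) (BlockIdx ℓ) ℝ := fun t => K t + N t * matDerivWithin K I t
  have hMapply : ∀ t p q, M t p q =
      (k q.1 q.2 t + N t *ᵥ vecDerivWithin (k q.1 q.2) I t) p := fun t p q => rfl
  have hK : MatContDiffOn (n + 1) K I := fun p q =>
    ((hk q.1).1 q.2).2 p 1 (by have := q.1.isLt; omega)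
  have hM : MatContDiffOn n M I := by
    intro p q
    refine ((hK p q).of_le ?_).add
      (ContDiffOn.sum (f := fun r t => N t p r * derivWithin (fun s => K s r q) I t) fun r _ => ?_)
    · exact_mod_cast le_self_add
    · exact ((hsmooth p r).of_le (by exact_mod_cast le_self_add)).mul
        ((hK r q).derivWithin hud (by exact_mod_cast le_rfl))
  -- `N K'` vanishes on and below the diagonal blocks, as `K` is block upper triangular
  have hNK : ∀ t ∈ I, ∀ p q : BlockIdx ℓ, (q.1 : ℕ) ≤ p.1 → M t p q = K t p q := by
    intro t ht p q hpq
    rw [hMapply, Pi.add_apply]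
    refine add_eq_left.2 (Finset.sum_eq_zero fun r _ => ?_)
    change N t p r * vecDerivWithin (k q.1 q.2) I t r = 0
    by_cases hr : (r.1 : ℕ) ≤ p.1
    · rw [hN.isSUT.apply_eq_zero ht hr, zero_mul]
    · rw [((hk q.1).1 q.2).deriv_eq_zero (by omega) ht, mul_zero]
  have hKtri : ∀ t ∈ I, ∀ p q : BlockIdx ℓ, (q.1 : ℕ) < p.1 → K t p q = 0 :=
    fun t ht p q h => ((hk q.1).1 q.2).1 p h t ht
  have hKu : ∀ t ∈ I, IsUnit (K t) := fun t ht =>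
    isUnit_of_block_triangular (hKtri t ht) fun j => (hk j).2 t ht
  have hMu : ∀ t ∈ I, IsUnit (M t) := fun t ht =>
    isUnit_of_block_triangular (fun p q h => (hNK t ht p q h.le).trans (hKtri t ht p q h))
      fun j => by
        have : block (M t) j j = block (K t) j j := by
          ext a b
          exact hNK t ht ⟨j, a⟩ ⟨j, b⟩ le_rfl
        rw [this]
        exact (hk j).2 t ht
  -- columnwise, `M E = N K` is the recursion `g + N g' = N f` linking consecutive block columns
  have hME : ∀ t ∈ I, M t * elemColumns ℓ = N t * K t := by
    intro t ht
    ext p ⟨j, a⟩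
    have hNKcol : (N t * K t) p ⟨j, a⟩ = (N t *ᵥ k j a t) p := rfl
    rw [hNKcol, Matrix.mul_apply]
    -- in the first block column both sides vanish: `E` has no entry there and `N` kills block `0`
    by_cases hj : (j : ℕ) = 0
    · rw [Finset.sum_eq_zero fun r _ => ?_]
      · refine (Finset.sum_eq_zero fun r _ => ?_).symm
        change N t p r * k j a t r = 0
        by_cases hr : (r.1 : ℕ) ≤ p.1
        · rw [hN.isSUT.apply_eq_zero ht hr, zero_mul]
        · rw [((hk j).1 a).1 r (by omega) t ht, mul_zero]
      · simp [elemColumns, hj]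
    · let i : Fin μ := ⟨j - 1, by omega⟩
      have hij : (j : ℕ) = i + 1 := by simp only [i]; omega
      have hle := hanti i j hij
      rw [← hrec i j hij hle a t ht, Finset.sum_eq_single ⟨i, Fin.castLE hle a⟩]
      · rw [hMapply]
        simp [elemColumns, hij]
      · rintro ⟨r, b⟩ - hr
        refine mul_eq_zero_of_right _ (if_neg ?_)
        rintro ⟨h1, h2⟩
        dsimp only at h1 h2
        obtain rfl : r = i := Fin.ext (by omega)
        exact hr (by rw [show b = Fin.castLE hle a from Fin.ext h2])
      · simp
  have hinv : ∀ t ∈ I, (M t)⁻¹ * M t = 1 := fun t ht =>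
    Matrix.nonsing_inv_mul _ ((Matrix.isUnit_iff_isUnit_det _).1 (hMu t ht))
  refine ⟨fun t => (M t)⁻¹, K, hM.inv hMu, hK, fun t ht => ?_, hKu, fun t ht => ?_, fun t ht => ?_⟩
  · exact Matrix.isUnit_nonsing_inv_iff.2 (hMu t ht)
  · rw [Matrix.mul_assoc, ← hME t ht, ← Matrix.mul_assoc, hinv t ht, Matrix.one_mul]
  · rw [Matrix.mul_one, Matrix.mul_assoc, ← Matrix.mul_add]
    exact (hinv t ht).symm
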